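/- **Setting.** Let $D=(D_1,\dots,D_N)$ be a dataset distributed over $N$ clients, each $D_i$ being a finite list of samples $(x,y)$. Call $D,D'$ *sample-adjacent* if, as multisets, they agree except for one client's local dataset, which differs by adding, removing or substituting one sample. A randomized mechanism $\mathcal M$ is *sample-level $(\varepsilon,\delta)$-DP* if $\Pr[\mathcal M(D)\in S]\le e^{\varepsilon}\Pr[\mathcal M(D')\in S]+\delta$ for all sample-adjacent $D,D'$ and all measurable $S$. **PowerDP.** On input $W\in\mathbb R^{m\times n}$, rank $r$, number of iterations $k$, norm bound $C$ and noise scale $\sigma$, draw $Q\in\mathbb R^{r\times n}$ with i.i.d. $\mathcal N(0,1)$ entries. Then repeat $k$ times: let $P$ be $WQ^{\top}$ with its columns orthonormalized, $A\gets P^{\top}W$, and let $Q$ be $A$ with its rows orthonormalized. (Gram–Schmidt is used; linearly dependent vectors become $0$.) Return $\tilde B=WQ^{\top}+Z_B$ and $\tilde A$, the row-orthonormalization of $A+Z_A$, where $Z_A,Z_B$ have i.i.d. $\mathcal N(0,\sigma^2C^2)$ entries. **FedPower.** The inputs are the numbers $T$ of global rounds, $L$ of local rounds and $k$ of power iterations,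 a learning rate $\eta$, a noise scale $\sigma$, a clipping threshold $C$, sampling rates $q_c,q_s\in[0,1]$, a weight matrix $W^0\in\mathbb R^{m\times n}$ and a loss $\ell(A,B,x,y)$. Start with $A^0\in\mathbb R^{r\times n}$ having i.i.d. $\mathcal N(0,\sigma^2)$ entries and $B^0=0\in\mathbb R^{m\times r}$. In round $t=1,\dots,T$, each client is sampled independently with probability $q_c$, giving the set $\mathcal C^t$. Each sampled client starts from $(A^{t-1},B^{t-1})$ and performs $L$ steps of gradient descent with learning rate $\eta$ on the average of $\ell$ over a fresh batch containing each local sample independently with probability $q_s$ (an empty batch gives no update; the gradient is read as $0$ where this average is not differentiable in $(A,B)$), producing $(A_i,B_i)$. The server sets $\Delta W_i=B_iA_i$, clips it in Frobenius norm, $\Delta W_i\gets\min(1,C/\|\Delta W_i\|_F)\,\Delta W_i$, averages, $\Delta W^t=\frac1{|\mathcal C^t|}\sum_{i\in\mathcal C^t}\Delta W_i$ (zero if $\mathcal C^t=\emptyset$), and obtains $(A^t,B^t)$ from PowerDP applied to $\Delta W^t$ with parameters $r,k,C,\sigma$. All random draws are independent. The output is $W^0+B^TA^T$ (the modules after round $T$).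 **Theorem (Sample-Level DP of FedPower).** For every $\delta_0<1$ there is a constant $c>0$, depending on $\delta_0$ only (so an absolute constant if, say, $\delta_0=\tfrac12$), such that for all $N,m,n,r,T,L\ge 0$, $k\ge1$, $C>0$, all $\eta,\sigma,q_c,q_s,W^0$ and $\ell$ as above, all $0<\varepsilon<c\,q_c^2q_s^2T$ and all $0<\delta\le\delta_0$: if $$\sigma\ \ge\ c\,\frac{q_cq_s\sqrt{T\log(1/\delta)}}{\varepsilon},$$ then FedPower run for $T$ rounds is sample-level $(\varepsilon,\delta)$-DP. -/

import Mathlib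

open MeasureTheory ProbabilityTheory

noncomputable section

namespace FedPower

/-- Real `a × b` matrices. -/
abbrev Mat (a b : ℕ) : Type := Matrix (Fin a) (Fin b) ℝ

/-- The product (equivalently, Borel) σ-algebra on matrices. -/
instance instMeasurableSpaceMat (a b : ℕ) : MeasurableSpace (Mat a b) :=
  inferInstanceAs (MeasurableSpace (Fin a → Fin b → ℝ))

/-! ### Differential privacy -/

/-- `(ε, δ)`-differential privacy of a randomized mechanism, given by the law `M D` of its output
on each dataset `D`, with respect to an adjacency relation on datasets. -/
def IsDP {𝒟 R : Type*} [MeasurableSpace R] (adj : 𝒟 → 𝒟 → Prop) (M : 𝒟 → Measure R)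
    (ε δ : ℝ) : Prop :=
  ∀ D D' : 𝒟, adj D D' → ∀ S : Set R, MeasurableSet S →
    M D S ≤ ENNReal.ofReal (Real.exp ε) * M D' S + ENNReal.ofReal δ

/-- A dataset distributed over `N` clients: each client holds a finite list of samples `(x, y)`
(the order is irrelevant, repetitions are allowed). -/
abbrev Dataset (X Y : Type*) (N : ℕ) : Type _ := Fin N → List (X × Y)

/-- Sample-level adjacency: the local datasets, as multisets, agree except for those of one client
`i`, which differ by the addition, the removal or the substitution of a single sample. -/
def SampleAdjacent {X Y : Type*} {N : ℕ} (D D' : Dataset X Y N) : Prop :=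
  ∃ i : Fin N, (∀ j, j ≠ i → (D' j : Multiset (X × Y)) = D j) ∧
    ((∃ z, (D' i : Multiset (X × Y)) = z ::ₘ (D i : Multiset (X × Y))) ∨
     (∃ z, (D i : Multiset (X × Y)) = z ::ₘ (D' i : Multiset (X × Y))) ∨
     (∃ (z z' : X × Y) (s : Multiset (X × Y)),
        (D i : Multiset (X × Y)) = z ::ₘ s ∧ (D' i : Multiset (X × Y)) = z' ::ₘ s))

/-! ### Matrix operations -/

/-- The law of an `a × b` matrix with independent `𝒩(0, s²)` entries. -/
def gaussianMatrix (a b : ℕ) (s : ℝ) : Measure (Mat a b) :=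
  Measure.pi fun _ : Fin a => Measure.pi fun _ : Fin b => gaussianReal 0 (Real.toNNReal (s ^ 2))

/-- The Frobenius norm. -/
def frobNorm {a b : ℕ} (M : Mat a b) : ℝ := √(∑ i, ∑ j, M i j ^ 2)

/-- Clipping to Frobenius norm at most `C`: `M` is rescaled by `min (1, C / ‖M‖)`. -/
def clip {a b : ℕ} (C : ℝ) (M : Mat a b) : Mat a b := min 1 (C / frobNorm M) • M

/-- Gram–Schmidt orthonormalization of the rows; a row that depends linearly on the preceding
ones is replaced by zero. -/
def orthRows {a b : ℕ} (M : Mat a b) : Mat a b :=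
  Matrix.of fun i j =>
    (InnerProductSpace.gramSchmidtNormed ℝ
      (fun i' : Fin a => (WithLp.toLp 2 (M i') : EuclideanSpace ℝ (Fin b))) i) j

/-- Gram–Schmidt orthonormalization of the columns. -/
def orthCols {a b : ℕ} (M : Mat a b) : Mat a b := (orthRows M.transpose).transpose

/-! ### PowerDP -/

/-- One subspace iteration. The state is `(A, Q)`: `P` is the column-orthonormalization of
`W Qᵀ`, the new `A` is `Pᵀ W`, and the new `Q` is the row-orthonormalization of the new `A`. -/
def powerStep {m n r : ℕ} (W : Mat m n) (s : Mat r n × Mat r n) : Mat r n × Mat r n :=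
  let P : Mat m r := orthCols (W * s.2.transpose)
  let A : Mat r n := P.transpose * W
  (A, orthRows A)

/-- PowerDP with `k` iterations, run with initial matrix `Q₀` and noise matrices `ZB`, `ZA`;
it returns the pair `(A, B)`. (The initial value of `A` is irrelevant as soon as `k ≥ 1`.) -/
def powerDP {m n r : ℕ} (k : ℕ) (W : Mat m n) (Q₀ : Mat r n) (ZB : Mat m r) (ZA : Mat r n) :
    Mat r n × Mat m r :=
  let s := (powerStep W)^[k] (0, Q₀)
  (orthRows (s.1 + ZA), W * s.2.transpose + ZB)

/-! ### FedPower -/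

/-- The input of FedPower other than the data. -/
structure Params (X Y : Type*) (m n r : ℕ) where
  /-- number of global rounds -/
  T : ℕ
  /-- number of local rounds -/
  L : ℕ
  /-- number of power iterations -/
  k : ℕ
  /-- learning rate -/
  η : ℝ
  /-- noise scale -/
  σ : ℝ
  /-- clipping threshold -/
  C : ℝ
  /-- client sampling rate -/
  qc : unitInterval
  /-- sample sampling rate -/
  qs : unitInterval
  /-- pre-trained weight matrix -/
  W₀ : Mat m n
  /-- the loss `ℓ(A, B, x, y)` -/
  loss : Mat r n → Mat m r → X → Y → ℝ

variable {X Y : Type*} {N m n r : ℕ}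

/-- The average loss over the batch of those samples `j` of the local dataset `d` that have
`b j = true` (zero for the empty batch). -/
def batchLoss (p : Params X Y m n r) (d : List (X × Y)) (b : Fin d.length → Bool)
    (s : Mat r n × Mat m r) : ℝ :=
  ((Finset.univ.filter fun j => b j = true).card : ℝ)⁻¹ *
    ∑ j ∈ Finset.univ.filter (fun j => b j = true), p.loss s.1 s.2 (d.get j).1 (d.get j).2

/-- The gradient with respect to the first matrix. -/
def gradA (f : Mat r n × Mat m r → ℝ) (s : Mat r n × Mat m r) : Mat r n :=
  Matrix.of fun i j => fderiv ℝ f s (Matrix.single i j 1, 0)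

/-- The gradient with respect to the second matrix. -/
def gradB (f : Mat r n × Mat m r → ℝ) (s : Mat r n × Mat m r) : Mat m r :=
  Matrix.of fun i j => fderiv ℝ f s (0, Matrix.single i j 1)

/-- Local training of one client: `L` steps of mini-batch gradient descent on the low-rank
modules `(A, B)`, the `l`-th step with batch `b l`. -/
def localTrain (p : Params X Y m n r) (d : List (X × Y)) (b : Fin p.L → Fin d.length → Bool)
    (s : Mat r n × Mat m r) : Mat r n × Mat m r :=
  Fin.foldl p.L (fun s l =>
    (s.1 - p.η • gradA (batchLoss p d (b l)) s, s.2 - p.η • gradB (batchLoss p d (b l)) s)) s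

/-- The randomness of one global round: which clients are sampled; which samples each client
draws in each local round; the initial matrix of PowerDP; its two noise matrices. -/
abbrev RoundRandomness (p : Params X Y m n r) (D : Dataset X Y N) : Type :=
  (Fin N → Bool) × ((i : Fin N) → Fin p.L → Fin (D i).length → Bool) ×
    Mat r n × Mat m r × Mat r n

/-- The law of the randomness of one round; everything is independent. Clients are sampled with
probability `qc`, samples with probability `qs`, the initial matrix of PowerDP is standard
Gaussian and its noise has standard deviation `σ C`. -/
def roundLaw (p : Params X Y m n r) (D : Dataset X Y N) : Measure (RoundRandomness p D) :=
  (Measure.pi fun _ : Fin N => bernoulliMeasure true false p.qc).prod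
    ((Measure.pi fun i : Fin N => Measure.pi fun _ : Fin p.L =>
        Measure.pi fun _ : Fin (D i).length => bernoulliMeasure true false p.qs).prod
      ((gaussianMatrix r n 1).prod
        ((gaussianMatrix m r (p.σ * p.C)).prod (gaussianMatrix r n (p.σ * p.C)))))

/-- The aggregated update `ΔW` of a round that starts from the modules `s = (A, B)`, with sampled
clients `S` and batches `b`: the average over the sampled clients of the clipped products `B A`
of the locally trained modules (zero if no client is sampled). -/
def aggregate (p : Params X Y m n r) (D : Dataset X Y N) (S : Fin N → Bool)
    (b : (i : Fin N) → Fin p.L → Fin (D i).length → Bool) (s : Mat r n × Mat m r) : Mat m n :=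
  ((Finset.univ.filter fun i => S i = true).card : ℝ)⁻¹ •
    ∑ i ∈ Finset.univ.filter (fun i => S i = true),
      clip p.C ((localTrain p (D i) (b i) s).2 * (localTrain p (D i) (b i) s).1)

/-- One global round: aggregation followed by the private refactorization. -/
def globalRound (p : Params X Y m n r) (D : Dataset X Y N) (s : Mat r n × Mat m r)
    (ω : RoundRandomness p D) : Mat r n × Mat m r :=
  powerDP p.k (aggregate p D ω.1 ω.2.1 s) ω.2.2.1 ω.2.2.2.1 ω.2.2.2.2

/-- The whole randomness of a run: the initial module `A⁰` and the randomness of the rounds. -/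
abbrev Randomness (p : Params X Y m n r) (D : Dataset X Y N) : Type :=
  Mat r n × (Fin p.T → RoundRandomness p D)

/-- The law of the whole randomness: `A⁰` has independent `𝒩(0, σ²)` entries, and the rounds use
fresh independent randomness. -/
def randomnessLaw (p : Params X Y m n r) (D : Dataset X Y N) : Measure (Randomness p D) :=
  (gaussianMatrix r n p.σ).prod (Measure.pi fun _ : Fin p.T => roundLaw p D)

/-- The output `Wᵀ = W⁰ + Bᵀ Aᵀ` (with `T` the number of rounds) of a run that starts from
`(A⁰, B⁰)`, `B⁰ = 0`. -/
def output (p : Params X Y m n r) (D : Dataset X Y N) (ω : Randomness p D) : Mat m n :=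
  let s := Fin.foldl p.T (fun s t => globalRound p D s (ω.2 t)) ((ω.1, 0) : Mat r n × Mat m r)
  p.W₀ + s.2 * s.1

/-- FedPower as a randomized mechanism: the law of its output on the dataset `D`. -/
def fedPower (p : Params X Y m n r) (D : Dataset X Y N) : Measure (Mat m n) :=
  (randomnessLaw p D).map (output p D)

/-! ### The output is measurable

These facts only ensure that the push-forward in `fedPower` is a genuine law. -/

lemma measurable_mat {Ω : Type*} [MeasurableSpace Ω] {a b : ℕ} {f : Ω → Mat a b}
    (h : ∀ i j, Measurable fun ω => f ω i j) : Measurable f :=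
  measurable_pi_iff.2 fun i => measurable_pi_iff.2 fun j => h i j

lemma measurable_entry {a b : ℕ} (i : Fin a) (j : Fin b) :
    Measurable fun M : Mat a b => M i j :=
  (measurable_pi_apply j).comp (measurable_pi_apply (X := fun _ : Fin a => Fin b → ℝ) i)

lemma measurable_entry_comp {Ω : Type*} [MeasurableSpace Ω] {a b : ℕ} {f : Ω → Mat a b}
    (h : Measurable f) (i : Fin a) (j : Fin b) : Measurable fun ω => f ω i j :=
  (measurable_entry i j).comp h

lemma measurable_mul {Ω : Type*} [MeasurableSpace Ω] {a b c : ℕ} {f : Ω → Mat a b}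
    {g : Ω → Mat b c} (hf : Measurable f) (hg : Measurable g) :
    Measurable fun ω => f ω * g ω :=
  measurable_mat fun i j => by
    simp only [Matrix.mul_apply]
    exact Finset.measurable_sum _ fun k _ => (measurable_entry_comp hf i k).mul (measurable_entry_comp hg k j)

lemma measurable_transp {Ω : Type*} [MeasurableSpace Ω] {a b : ℕ} {f : Ω → Mat a b}
    (hf : Measurable f) : Measurable fun ω => (f ω).transpose :=
  measurable_mat fun i j => measurable_entry_comp hf j i

lemma measurable_madd {Ω : Type*} [MeasurableSpace Ω] {a b : ℕ} {f g : Ω → Mat a b}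
    (hf : Measurable f) (hg : Measurable g) : Measurable fun ω => f ω + g ω :=
  measurable_mat fun i j => (measurable_entry_comp hf i j).add (measurable_entry_comp hg i j)

lemma measurable_msub {Ω : Type*} [MeasurableSpace Ω] {a b : ℕ} {f g : Ω → Mat a b}
    (hf : Measurable f) (hg : Measurable g) : Measurable fun ω => f ω - g ω :=
  measurable_mat fun i j => (measurable_entry_comp hf i j).sub (measurable_entry_comp hg i j)

lemma measurable_msmul {Ω : Type*} [MeasurableSpace Ω] {a b : ℕ} {f : Ω → ℝ} {g : Ω → Mat a b}
    (hf : Measurable f) (hg : Measurable g) : Measurable fun ω => f ω • g ω :=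
  measurable_mat fun i j => hf.mul (measurable_entry_comp hg i j)

lemma measurable_frobNorm {a b : ℕ} : Measurable (frobNorm : Mat a b → ℝ) := by
  unfold frobNorm
  refine Measurable.sqrt (Finset.measurable_sum _ fun i _ => Finset.measurable_sum _ fun j _ => ?_)
  exact (measurable_entry i j).pow_const 2

lemma measurable_clip {a b : ℕ} (C : ℝ) : Measurable (clip C : Mat a b → Mat a b) :=
  measurable_msmul (measurable_const.min (measurable_const.div measurable_frobNorm)) measurable_id

lemma measurable_gs {a b : ℕ} (i : Fin a) : Measurable fun M : Mat a b =>
    InnerProductSpace.gramSchmidt ℝ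
      (fun i' : Fin a => (WithLp.toLp 2 (M i') : EuclideanSpace ℝ (Fin b))) i := by
  induction i using WellFoundedLT.induction with
  | ind i ih =>
    have hrow : Measurable fun M : Mat a b =>
        (WithLp.toLp 2 (M i) : EuclideanSpace ℝ (Fin b)) :=
      (PiLp.continuous_toLp 2 _).measurable.comp
        (measurable_pi_apply (X := fun _ : Fin a => Fin b → ℝ) i)
    simp only [InnerProductSpace.gramSchmidt_def ℝ _ i, Submodule.starProjection_singleton]
    refine hrow.sub (Finset.measurable_fun_sum _ fun j hj => ?_)
    have := ih j (Finset.mem_Iio.1 hj)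
    exact ((this.inner hrow).div (by simpa using this.norm.pow_const 2)).smul this

lemma measurable_orthRows {a b : ℕ} : Measurable (orthRows : Mat a b → Mat a b) := by
  refine measurable_mat fun i j => ?_
  have h := measurable_gs (b := b) i
  have h2 : Measurable fun M : Mat a b => InnerProductSpace.gramSchmidtNormed ℝ
      (fun i' : Fin a => (WithLp.toLp 2 (M i') : EuclideanSpace ℝ (Fin b))) i := by
    unfold InnerProductSpace.gramSchmidtNormed
    exact (h.norm.inv).smul h
  exact (measurable_pi_apply j).comp ((PiLp.continuous_ofLp 2 _).measurable.comp h2)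

lemma measurable_orthCols {a b : ℕ} : Measurable (orthCols : Mat a b → Mat a b) :=
  measurable_transp (measurable_orthRows.comp (measurable_transp measurable_id))

lemma measurable_powerIter {Ω : Type*} [MeasurableSpace Ω] {m n r : ℕ} {W : Ω → Mat m n}
    (hW : Measurable W) (k : ℕ) : ∀ {s : Ω → Mat r n × Mat r n}, Measurable s →
    Measurable fun ω => (powerStep (W ω))^[k] (s ω) := by
  induction k with
  | zero => intro s hs; simpa using hs
  | succ k ih =>
    intro s hs
    simp only [Function.iterate_succ, Function.comp]
    apply ih
    have hA : Measurable fun ω =>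
        (orthCols (W ω * (s ω).2.transpose)).transpose * W ω :=
      measurable_mul (measurable_transp (measurable_orthCols.comp
        (measurable_mul hW (measurable_transp hs.snd)))) hW
    exact hA.prodMk (measurable_orthRows.comp hA)

lemma measurable_powerDP {Ω : Type*} [MeasurableSpace Ω] {m n r : ℕ} (k : ℕ) {W : Ω → Mat m n}
    {Q ZA : Ω → Mat r n} {ZB : Ω → Mat m r} (hW : Measurable W) (hQ : Measurable Q)
    (hB : Measurable ZB) (hA : Measurable ZA) :
    Measurable fun ω => powerDP k (W ω) (Q ω) (ZB ω) (ZA ω) := by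
  have := measurable_powerIter hW k ((measurable_const (a := (0 : Mat r n))).prodMk hQ)
  exact (measurable_orthRows.comp (measurable_madd this.fst hA)).prodMk
    (measurable_madd (measurable_mul hW (measurable_transp this.snd)) hB)

lemma measurable_fderivMat {m n r : ℕ} (f : Mat r n × Mat m r → ℝ) (v : Mat r n × Mat m r) :
    Measurable fun s => fderiv ℝ f s v :=
  measurable_fderiv_apply_const (E := (Fin r → Fin n → ℝ) × (Fin m → Fin r → ℝ)) ℝ f v

lemma measurable_localTrain (p : Params X Y m n r) (d : List (X × Y))
    (b : Fin p.L → Fin d.length → Bool) : Measurable (localTrain p d b) := by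
  unfold localTrain
  generalize p.L = L at b
  induction L with
  | zero => simpa using measurable_id'
  | succ L ih =>
    simp only [Fin.foldl_succ_last]
    have h := ih (fun l => b l.castSucc)
    refine Measurable.comp (g := fun s : Mat r n × Mat m r =>
      (s.1 - p.η • gradA (batchLoss p d (b (Fin.last L))) s,
        s.2 - p.η • gradB (batchLoss p d (b (Fin.last L))) s)) ?_ h
    refine (measurable_msub measurable_fst (measurable_msmul measurable_const ?_)).prodMk
      (measurable_msub measurable_snd (measurable_msmul measurable_const ?_))
    · exact measurable_mat fun i j => measurable_fderivMat _ _
    · exact measurable_mat fun i j => measurable_fderivMat _ _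

lemma measurable_aggregate (p : Params X Y m n r) (D : Dataset X Y N) (S : Fin N → Bool)
    (b : (i : Fin N) → Fin p.L → Fin (D i).length → Bool) : Measurable (aggregate p D S b) := by
  refine measurable_msmul measurable_const ?_
  refine measurable_mat fun i j => ?_
  simp only [Matrix.sum_apply]
  refine Finset.measurable_sum _ fun l _ => ?_
  have h := measurable_localTrain p (D l) (b l)
  exact measurable_entry_comp ((measurable_clip p.C).comp (measurable_mul h.snd h.fst)) i j

lemma measurable_aggregate' (p : Params X Y m n r) (D : Dataset X Y N) :
    Measurable fun y : ((Fin N → Bool) × ((i : Fin N) → Fin p.L → Fin (D i).length → Bool)) ×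
      (Mat r n × Mat m r) => aggregate p D y.1.1 y.1.2 y.2 :=
  measurable_from_prod_countable_right fun y => measurable_aggregate p D y.1 y.2

lemma measurable_globalRound (p : Params X Y m n r) (D : Dataset X Y N) {Ω : Type*}
    [MeasurableSpace Ω] {f : Ω → Mat r n × Mat m r} {g : Ω → RoundRandomness p D}
    (hf : Measurable f) (hg : Measurable g) :
    Measurable fun x => globalRound p D (f x) (g x) := by
  have h := (measurable_aggregate' p D).comp ((hg.fst.prodMk hg.snd.fst).prodMk hf)
  exact measurable_powerDP p.k h hg.snd.snd.fst hg.snd.snd.snd.fst hg.snd.snd.snd.snd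

lemma measurable_foldl {R M Ω : Type*} [MeasurableSpace R] [MeasurableSpace M] [MeasurableSpace Ω]
    (F : M → R → M)
    (hF : Measurable fun x : M × R => F x.1 x.2) (T : ℕ) {a : Ω → M} {ω : Ω → Fin T → R}
    (ha : Measurable a) (hω : ∀ t, Measurable fun x => ω x t) :
    Measurable fun x => Fin.foldl T (fun s t => F s (ω x t)) (a x) := by
  induction T with
  | zero => simpa using ha
  | succ T ih =>
    simp only [Fin.foldl_succ_last]
    exact hF.comp ((ih (ω := fun x t => ω x t.castSucc) fun t => hω _).prodMk (hω _))

lemma measurable_output (p : Params X Y m n r) (D : Dataset X Y N) : Measurable (output p D) := by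
  have h := measurable_foldl (globalRound p D)
    (measurable_globalRound p D measurable_fst measurable_snd) p.T
    (a := fun ω : Randomness p D => ((ω.1, 0) : Mat r n × Mat m r))
    (ω := fun ω => ω.2)
    (measurable_fst.prodMk measurable_const)
    (fun t => (measurable_pi_apply t).comp measurable_snd)
  exact measurable_madd measurable_const (measurable_mul h.snd h.fst)

instance (a b : ℕ) (s : ℝ) : IsProbabilityMeasure (gaussianMatrix a b s) :=
  inferInstanceAs (IsProbabilityMeasure
    (Measure.pi fun _ : Fin a => Measure.pi fun _ : Fin b => gaussianReal 0 (Real.toNNReal (s ^ 2))))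

instance (p : Params X Y m n r) (D : Dataset X Y N) : IsProbabilityMeasure (roundLaw p D) := by
  unfold roundLaw; infer_instance

instance (p : Params X Y m n r) (D : Dataset X Y N) : IsProbabilityMeasure (randomnessLaw p D) := by
  unfold randomnessLaw; infer_instance

/-- The output is a genuine random variable, so its law is a probability measure. -/
instance (p : Params X Y m n r) (D : Dataset X Y N) : IsProbabilityMeasure (fedPower p D) :=
  Measure.isProbabilityMeasure_map (measurable_output p D).aemeasurable

end FedPower

end

/-!
Only the noise of the last round is needed, and the privacy guarantee holds for arbitrary pairs of
datasets.

Whatever happened before, the update `ΔW` of the last round is an average of clipped matrices and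
has Frobenius norm at most `C` (`frobNorm_aggregate_le`). The matrices `W Qᵀ` and `A` that PowerDP
perturbs by noise are products of `ΔW` with partial isometries, so they also have norm at most `C`
(`frobNorm_powerStep_iterate_le`, by Bessel's inequality). Conditionally on everything but the last
noise `Z = (Z_B, Z_A)`, the output is therefore `f (Z + M)` with
`f (b, a) = W⁰ + b · orthRows a` and `‖M‖² ≤ 2 C²`. The law of the output on any dataset is a
mixture of such laws (`exists_law_foldl`, `fedPower_apply_bounds`), and it is enough to compare each
of them with the law of `f Z`, which does not depend on the data.

The Gaussian mechanism alone has a privacy loss of order `1 / σ`, which would be too much when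
`q_c q_s √T` is small. The product of the factors, however, does not change when both factors change
sign: `orthRows` is odd, so `f` is even (`neg_mem_factorSet`). On symmetric sets the shifts by `M`
and `-M` have the same mass, and averaging the two densities `exp (±φ - q / 2)` leaves
`exp (-q / 2) cosh φ` (`HasGaussianShift.measure_shift_eq`). Here `φ` is a centred Gaussian of
variance `q ≤ 2 / σ²`, so the logarithm of this density is quadratic in `1 / σ`. It is bounded below
by `-q / 2`, and from above, outside a set of small mass, by a Chernoff estimate
(`HasGaussianShift.measure_shift_le`). The outcome is `(ε, δ)`-privacy as soon as `σ² ε` exceeds a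
multiple of `1 + log (1 / δ)` (`fedPower_isDP_of_sq_mul_le`).

The hypotheses give exactly this: with `u = q_c q_s`, the bounds `ε < c u² T` and
`σ ≥ c u √(T log (1 / δ)) / ε` imply `σ² ε ≥ c log (1 / δ)`, and `log (1 / δ) ≥ log (1 / δ₀) > 0`
allows `c` to absorb the additive constant.
-/

namespace FedPower

/-! ### Gaussian shifts of product measures -/

lemma lintegral_pi_fin_prod {a : ℕ} {E : Type*} [MeasurableSpace E]
    (μ : Fin a → Measure E) [∀ i, SigmaFinite (μ i)] {f : Fin a → E → ENNReal}
    (hf : ∀ i, Measurable (f i)) :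
    ∫⁻ x, ∏ i, f i (x i) ∂Measure.pi μ = ∏ i, ∫⁻ x, f i x ∂μ i := by
  induction a with
  | zero => simp
  | succ a ih =>
    have hm : Measurable fun x : Fin (a + 1) → E => ∏ i, f i (x i) :=
      Finset.measurable_fun_prod _ fun i _ => (hf i).comp (measurable_pi_apply i)
    have hm' : Measurable fun x : Fin a → E => ∏ i : Fin a, f i.succ (x i) :=
      Finset.measurable_fun_prod _ fun i _ => (hf _).comp (measurable_pi_apply i)
    rw [Fin.prod_univ_succ, ← ih (fun i => μ i.succ) (f := fun i => f i.succ) fun i => hf _,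
      ← lintegral_prod_mul (hf 0).aemeasurable hm'.aemeasurable,
      ← ((measurePreserving_piFinSuccAbove μ 0).symm).lintegral_comp hm]
    refine lintegral_congr fun x => ?_
    rw [Fin.prod_univ_succ]
    rfl

lemma pi_withDensity_fin {a : ℕ} {E : Type*} [MeasurableSpace E]
    (μ : Measure E) [SigmaFinite μ] {f : Fin a → E → ENNReal} (hf : ∀ i, Measurable (f i))
    [∀ i, SigmaFinite (μ.withDensity (f i))] :
    Measure.pi (fun i => μ.withDensity (f i)) =
      (Measure.pi fun _ => μ).withDensity fun x => ∏ i, f i (x i) := by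
  refine Measure.pi_eq fun s hs => ?_
  rw [withDensity_apply _ (MeasurableSet.univ_pi hs), Measure.restrict_pi_pi,
    lintegral_pi_fin_prod _ hf]
  exact Finset.prod_congr rfl fun i _ => (withDensity_apply _ (hs i)).symm

/-- `ν` is symmetric, and its translate by `t • a` has density `exp (t φ - t² q / 2)` with respect
to `ν`. This is the Cameron–Martin formula: for a centred Gaussian `ν`, `φ` is the linear functional
dual to `a`, and `q` is its variance. -/
structure HasGaussianShift {G : Type*} [Add G] [Neg G] [SMul ℝ G] [MeasurableSpace G]
    (ν : Measure G) (a : G) (φ : G → ℝ) (q : ℝ) : Prop where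
  measurable : Measurable φ
  map_neg : ν.map (fun x => -x) = ν
  map_add : ∀ t : ℝ, ν.map (· + t • a) =
    ν.withDensity fun x => ENNReal.ofReal (Real.exp (t * φ x - t ^ 2 * q / 2))

lemma hasGaussianShift_gaussianReal {v : NNReal} (hv : v ≠ 0) (a : ℝ) :
    HasGaussianShift (gaussianReal 0 v) a (fun x => a * x / v) (a ^ 2 / v) := by
  refine ⟨by fun_prop, by rw [gaussianReal_map_neg, neg_zero], fun t => ?_⟩
  rw [gaussianReal_map_add_const, gaussianReal_of_var_ne_zero _ hv, gaussianReal_of_var_ne_zero _ hv,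
    ← withDensity_mul _ (measurable_gaussianPDF _ _) (by fun_prop)]
  congr 1
  ext x
  have hv' : (v : ℝ) ≠ 0 := by exact_mod_cast hv
  simp only [gaussianPDF, Pi.mul_apply]
  rw [← ENNReal.ofReal_mul (gaussianPDFReal_nonneg _ _ _), gaussianPDFReal, gaussianPDFReal,
    mul_assoc _ (Real.exp _), ← Real.exp_add, smul_eq_mul]
  congr 3
  field_simp
  ring

section Products

variable {G H : Type*} [Add G] [Neg G] [SMul ℝ G] [MeasurableSpace G] [MeasurableAdd G]
  [MeasurableNeg G] [Add H] [Neg H] [SMul ℝ H] [MeasurableSpace H] [MeasurableAdd H]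
  [MeasurableNeg H]

lemma HasGaussianShift.prod {ν : Measure G} {ρ : Measure H} [IsProbabilityMeasure ν]
    [IsProbabilityMeasure ρ] {a : G} {b : H} {φ : G → ℝ} {ψ : H → ℝ} {q s : ℝ}
    (h : HasGaussianShift ν a φ q) (h' : HasGaussianShift ρ b ψ s) :
    HasGaussianShift (ν.prod ρ) (a, b) (fun x => φ x.1 + ψ x.2) (q + s) := by
  have m := h.measurable
  have m' := h'.measurable
  refine ⟨by fun_prop, ?_, fun t => ?_⟩
  · have := Measure.map_prod_map ν ρ (measurable_neg (G := G)) (measurable_neg (G := H))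
    rw [h.map_neg, h'.map_neg] at this
    exact this.symm
  have := Measure.map_prod_map ν ρ (measurable_add_const (t • a)) (measurable_add_const (t • b))
  rw [h.map_add, h'.map_add, prod_withDensity (by fun_prop) (by fun_prop)] at this
  refine this.symm.trans ?_
  congr 1
  ext x
  rw [← ENNReal.ofReal_mul (Real.exp_nonneg _), ← Real.exp_add]
  congr 2
  ring

lemma HasGaussianShift.pi {k : ℕ} {ν : Measure G} [IsProbabilityMeasure ν] {a : Fin k → G}
    {φ : Fin k → G → ℝ} {q : Fin k → ℝ} (h : ∀ i, HasGaussianShift ν (a i) (φ i) (q i))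
    (hν : ν.map (fun x => -x) = ν) :
    HasGaussianShift (Measure.pi fun _ : Fin k => ν) a (fun x => ∑ i, φ i (x i)) (∑ i, q i) := by
  have m := fun i => (h i).measurable
  refine ⟨by fun_prop, ?_, fun t => ?_⟩
  · have hp : SigmaFinite (ν.map fun x => -x) := by rw [hν]; infer_instance
    have := Measure.pi_map_pi (μ := fun _ : Fin k => ν) (f := fun _ x => -x)
      fun _ => measurable_neg.aemeasurable
    rw [hν] at this
    exact this
  have hp : ∀ i, IsProbabilityMeasure (ν.map (· + t • a i)) := fun i =>
    Measure.isProbabilityMeasure_map (measurable_add_const _).aemeasurable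
  have := Measure.pi_map_pi (μ := fun _ : Fin k => ν) (f := fun i x => x + t • a i)
    fun i => (measurable_add_const _).aemeasurable
  have hp' : ∀ i, IsProbabilityMeasure
      (ν.withDensity fun x => ENNReal.ofReal (Real.exp (t * φ i x - t ^ 2 * q i / 2))) :=
    fun i => by rw [← (h i).map_add]; exact hp i
  simp only [(h _).map_add] at this
  rw [pi_withDensity_fin _ fun i => by fun_prop] at this
  refine this.trans ?_
  congr 1
  ext x
  rw [← ENNReal.ofReal_prod_of_nonneg fun i _ => Real.exp_nonneg _, ← Real.exp_sum]
  congr 2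
  rw [Finset.sum_sub_distrib, ← Finset.sum_div, Finset.mul_sum, Finset.mul_sum]

end Products

/-! ### Shifted mass of symmetric sets -/

lemma cosh_le_exp_abs (x : ℝ) : Real.cosh x ≤ Real.exp |x| := by
  rw [← Real.cosh_abs, Real.cosh_eq]
  have : Real.exp (-|x|) ≤ Real.exp |x| := Real.exp_le_exp.2 (by linarith [abs_nonneg x])
  linarith

section SymmetricSets

variable {G : Type*} [AddCommGroup G] [Module ℝ G] [MeasurableSpace G] [MeasurableAdd G]
  {ν : Measure G} {a : G} {φ : G → ℝ} {q : ℝ}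

/-- The moment generating function of `φ`, read off from the total mass of a translate. -/
lemma HasGaussianShift.lintegral_exp [IsProbabilityMeasure ν] (h : HasGaussianShift ν a φ q)
    (t : ℝ) : ∫⁻ x, ENNReal.ofReal (Real.exp (t * φ x)) ∂ν =
      ENNReal.ofReal (Real.exp (t ^ 2 * q / 2)) := by
  have m := h.measurable
  have h1 : (ν.map (· + t • a)) Set.univ = 1 := by
    rw [Measure.map_apply (measurable_add_const _) MeasurableSet.univ]; simp
  rw [h.map_add, withDensity_apply _ MeasurableSet.univ, Measure.restrict_univ] at h1
  calc ∫⁻ x, ENNReal.ofReal (Real.exp (t * φ x)) ∂ν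
      = ∫⁻ x, ENNReal.ofReal (Real.exp (t ^ 2 * q / 2)) *
          ENNReal.ofReal (Real.exp (t * φ x - t ^ 2 * q / 2)) ∂ν := by
        refine lintegral_congr fun x => ?_
        rw [← ENNReal.ofReal_mul (Real.exp_nonneg _), ← Real.exp_add]
        congr 2; ring
    _ = _ := by rw [lintegral_const_mul _ (by fun_prop), h1, mul_one]

/-- On a symmetric set the translates by `a` and by `-a` have the same mass, so that the linear
term of the log-density cancels and `exp φ` is replaced by `cosh φ`. -/
lemma HasGaussianShift.measure_shift_eq [MeasurableNeg G] (h : HasGaussianShift ν a φ q) {U : Set G}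
    (hU : MeasurableSet U) (hneg : ∀ x, -x ∈ U ↔ x ∈ U) :
    ν ((· + a) ⁻¹' U) = ∫⁻ x in U, ENNReal.ofReal (Real.exp (-q / 2) * Real.cosh (φ x)) ∂ν := by
  have m := h.measurable
  have hpos : ν ((· + a) ⁻¹' U) = ∫⁻ x in U, ENNReal.ofReal (Real.exp (φ x - q / 2)) ∂ν := by
    have := congrArg (· U) (h.map_add 1)
    simpa [Measure.map_apply (measurable_add_const a) hU, withDensity_apply _ hU] using this
  have hsub : ν ((· + a) ⁻¹' U) = ∫⁻ x in U, ENNReal.ofReal (Real.exp (-φ x - q / 2)) ∂ν := by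
    have := congrArg (· U) (h.map_add (-1))
    simp only [neg_smul, one_smul, Measure.map_apply (measurable_add_const (-a)) hU,
      withDensity_apply _ hU] at this
    have e : ν ((· + a) ⁻¹' U) = ν ((· + -a) ⁻¹' U) := by
      conv_lhs => rw [← h.map_neg]
      rw [Measure.map_apply measurable_neg (measurable_add_const a hU)]
      congr 1
      ext x
      simp only [Set.mem_preimage]
      rw [← hneg, neg_add, neg_neg]
    rw [e, this]
    simp
  have htwo : ν ((· + a) ⁻¹' U) + ν ((· + a) ⁻¹' U) =
      2 * ∫⁻ x in U, ENNReal.ofReal (Real.exp (-q / 2) * Real.cosh (φ x)) ∂ν := by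
    conv_lhs => rw [hpos]
    conv_lhs => arg 2; rw [← hpos, hsub]
    rw [← lintegral_add_left (by fun_prop), ← lintegral_const_mul _ (by fun_prop)]
    refine lintegral_congr fun x => ?_
    rw [← ENNReal.ofReal_add (Real.exp_nonneg _) (Real.exp_nonneg _),
      ← ENNReal.ofReal_ofNat 2, ← ENNReal.ofReal_mul (by norm_num)]
    congr 1
    rw [Real.cosh_eq, sub_eq_add_neg, sub_eq_add_neg, Real.exp_add, Real.exp_add, neg_div]
    ring
  rw [← two_mul] at htwo
  exact (ENNReal.mul_right_inj (by norm_num) (by norm_num)).1 htwo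

lemma HasGaussianShift.measure_le_measure_shift [MeasurableNeg G]
    (h : HasGaussianShift ν a φ q) {κ : ℝ} (hq : q ≤ κ) {U : Set G} (hU : MeasurableSet U) (hneg : ∀ x, -x ∈ U ↔ x ∈ U) :
    ν U ≤ ENNReal.ofReal (Real.exp (κ / 2)) * ν ((· + a) ⁻¹' U) := by
  have m := h.measurable
  rw [h.measure_shift_eq hU hneg, ← lintegral_const_mul _ (by fun_prop), ← setLIntegral_one]
  refine lintegral_mono fun x => ?_
  rw [← ENNReal.ofReal_mul (Real.exp_nonneg _), ENNReal.one_le_ofReal, ← mul_assoc,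
    ← Real.exp_add]
  exact one_le_mul_of_one_le_of_one_le (Real.one_le_exp (by linarith)) (Real.one_le_cosh _)

/-- The density `exp (-q / 2) cosh φ` exceeds `exp τ` only where `|φ| ≥ t`; the mass of that event
is bounded by a Chernoff estimate with parameter `lam`. -/
lemma HasGaussianShift.measure_shift_le [MeasurableNeg G] [IsProbabilityMeasure ν]
    (h : HasGaussianShift ν a φ q) {κ τ t lam : ℝ} (hq₀ : 0 ≤ q) (hq : q ≤ κ) (hlam : 0 ≤ lam)
    (ht : ∀ x : ℝ, Real.exp τ < Real.cosh x → t ≤ |x|)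
    {U : Set G} (hU : MeasurableSet U) (hneg : ∀ x, -x ∈ U ↔ x ∈ U) :
    ν ((· + a) ⁻¹' U) ≤ ENNReal.ofReal (Real.exp τ) * ν U +
      ENNReal.ofReal (2 * Real.exp ((lam + lam ^ 2 / 2) * κ - lam * t)) := by
  have m := h.measurable
  have hpt : ∀ x : ℝ, Real.exp (-q / 2) * Real.cosh x ≤ Real.exp τ +
      Real.exp (-q / 2 - lam * t) * (Real.exp ((1 + lam) * x) + Real.exp (-(1 + lam) * x)) := by
    intro x
    -- the second summand is a multiple of `2 cosh ((1 + lam) x) ≥ exp ((1 + lam) |x|)`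
    have hnn : 0 ≤ Real.exp (-q / 2 - lam * t) *
        (Real.exp ((1 + lam) * x) + Real.exp (-(1 + lam) * x)) := by positivity
    have hle : Real.exp (-q / 2) * Real.cosh x ≤ Real.cosh x :=
      mul_le_of_le_one_left (Real.cosh_pos x).le (Real.exp_le_one_iff.2 (by linarith))
    rcases le_or_gt (Real.cosh x) (Real.exp τ) with hx | hx
    · linarith
    have htx := ht x hx
    have h1 := cosh_le_exp_abs x
    have h2 : Real.exp ((1 + lam) * |x|) ≤
        Real.exp ((1 + lam) * x) + Real.exp (-(1 + lam) * x) := by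
      rcases abs_cases x with ⟨e, _⟩ | ⟨e, _⟩ <;> rw [e]
      · linarith [Real.exp_pos (-(1 + lam) * x)]
      · rw [mul_neg, ← neg_mul]; linarith [Real.exp_pos ((1 + lam) * x)]
    have h3 : Real.exp (-q / 2) * Real.exp |x| ≤
        Real.exp (-q / 2 - lam * t) * Real.exp ((1 + lam) * |x|) := by
      rw [← Real.exp_add, ← Real.exp_add]
      exact Real.exp_le_exp.2 (by nlinarith)
    have h4 := mul_le_mul_of_nonneg_left h1 (Real.exp_nonneg (-q / 2))
    have h5 := mul_le_mul_of_nonneg_left h2 (Real.exp_nonneg (-q / 2 - lam * t))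
    linarith [Real.exp_pos τ]
  rw [h.measure_shift_eq hU hneg]
  calc ∫⁻ x in U, ENNReal.ofReal (Real.exp (-q / 2) * Real.cosh (φ x)) ∂ν
      ≤ ∫⁻ x in U, (ENNReal.ofReal (Real.exp τ) + ENNReal.ofReal (Real.exp (-q / 2 - lam * t)) *
          (ENNReal.ofReal (Real.exp ((1 + lam) * φ x)) +
            ENNReal.ofReal (Real.exp (-(1 + lam) * φ x)))) ∂ν := by
        refine lintegral_mono fun x => ?_
        rw [← ENNReal.ofReal_add (Real.exp_nonneg _) (Real.exp_nonneg _),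
          ← ENNReal.ofReal_mul (Real.exp_nonneg _),
          ← ENNReal.ofReal_add (Real.exp_nonneg _) (by positivity)]
        exact ENNReal.ofReal_le_ofReal (hpt _)
    _ = ENNReal.ofReal (Real.exp τ) * ν U +
          ∫⁻ x in U, ENNReal.ofReal (Real.exp (-q / 2 - lam * t)) *
          (ENNReal.ofReal (Real.exp ((1 + lam) * φ x)) +
            ENNReal.ofReal (Real.exp (-(1 + lam) * φ x))) ∂ν := by
        rw [lintegral_add_left (by fun_prop), setLIntegral_const]
    _ ≤ ENNReal.ofReal (Real.exp τ) * ν U +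
          ∫⁻ x, ENNReal.ofReal (Real.exp (-q / 2 - lam * t)) *
          (ENNReal.ofReal (Real.exp ((1 + lam) * φ x)) +
            ENNReal.ofReal (Real.exp (-(1 + lam) * φ x))) ∂ν := by
        gcongr
        exact Measure.restrict_le_self
    _ ≤ _ := by
        gcongr
        rw [lintegral_const_mul _ (by fun_prop), lintegral_add_left (by fun_prop),
          h.lintegral_exp, h.lintegral_exp, neg_sq,
          ← ENNReal.ofReal_add (Real.exp_nonneg _) (Real.exp_nonneg _),
          ← ENNReal.ofReal_mul (Real.exp_nonneg _), ← two_mul, mul_left_comm, ← Real.exp_add]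
        refine ENNReal.ofReal_le_ofReal ?_
        have : (lam + lam ^ 2 / 2) * q ≤ (lam + lam ^ 2 / 2) * κ :=
          mul_le_mul_of_nonneg_left hq (by positivity)
        have : Real.exp (-q / 2 - lam * t + (1 + lam) ^ 2 * q / 2) ≤
            Real.exp ((lam + lam ^ 2 / 2) * κ - lam * t) := Real.exp_le_exp.2 (by nlinarith)
        linarith

end SymmetricSets

/-! ### Gaussian matrices -/

instance instMeasurableAddMat (a b : ℕ) : MeasurableAdd (Mat a b) :=
  inferInstanceAs (MeasurableAdd (Fin a → Fin b → ℝ))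

instance instMeasurableNegMat (a b : ℕ) : MeasurableNeg (Mat a b) :=
  inferInstanceAs (MeasurableNeg (Fin a → Fin b → ℝ))

instance instMeasurableAddProd {G H : Type*} [Add G] [Add H] [MeasurableSpace G]
    [MeasurableSpace H] [MeasurableAdd G] [MeasurableAdd H] : MeasurableAdd (G × H) where
  measurable_const_add c := (measurable_const_add c.1).prodMap (measurable_const_add c.2)
  measurable_add_const c := (measurable_add_const c.1).prodMap (measurable_add_const c.2)

instance instMeasurableNegProd {G H : Type*} [Neg G] [Neg H] [MeasurableSpace G]
    [MeasurableSpace H] [MeasurableNeg G] [MeasurableNeg H] : MeasurableNeg (G × H) where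
  measurable_neg := measurable_neg.prodMap measurable_neg

lemma gaussianReal_map_neg_self (v : NNReal) :
    (gaussianReal 0 v).map (fun x => -x) = gaussianReal 0 v := by
  rw [gaussianReal_map_neg, neg_zero]

lemma frobNorm_sq {a b : ℕ} (M : Mat a b) : frobNorm M ^ 2 = ∑ i, ∑ j, M i j ^ 2 :=
  Real.sq_sqrt (Finset.sum_nonneg fun _ _ => Finset.sum_nonneg fun _ _ => sq_nonneg _)

lemma exists_hasGaussianShift_gaussianMatrix {a b : ℕ} {s : ℝ} (hs : s ≠ 0) (M : Mat a b) :
    ∃ φ, HasGaussianShift (gaussianMatrix a b s) M φ (frobNorm M ^ 2 / s ^ 2) := by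
  have hv : Real.toNNReal (s ^ 2) ≠ 0 := (Real.toNNReal_pos.2 (by positivity)).ne'
  have hrow := fun i : Fin a => HasGaussianShift.pi
    (fun j : Fin b => hasGaussianShift_gaussianReal hv (M i j)) (gaussianReal_map_neg_self _)
  have h := HasGaussianShift.pi hrow (by
    have := (HasGaussianShift.pi (fun j : Fin b => hasGaussianShift_gaussianReal hv 0)
      (gaussianReal_map_neg_self _)).map_neg
    exact this)
  have hq : frobNorm M ^ 2 / s ^ 2 = ∑ i, ∑ j, M i j ^ 2 / (Real.toNNReal (s ^ 2) : ℝ) := by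
    simp only [frobNorm_sq, Finset.sum_div, Real.coe_toNNReal _ (sq_nonneg s)]
  rw [hq]
  exact ⟨_, h⟩

/-! ### Sizes of the matrices in PowerDP -/

section Frobenius

attribute [local instance] Matrix.frobeniusNormedAddCommGroup Matrix.frobeniusNormedSpace

lemma frobNorm_eq_norm {a b : ℕ} (M : Mat a b) : frobNorm M = ‖M‖ := by
  rw [Matrix.frobenius_norm_def, frobNorm, Real.sqrt_eq_rpow]
  simp

lemma frobNorm_clip_le {a b : ℕ} {C : ℝ} (hC : 0 < C) (M : Mat a b) : frobNorm (clip C M) ≤ C := by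
  rw [clip, frobNorm_eq_norm, frobNorm_eq_norm, norm_smul, Real.norm_of_nonneg (by positivity)]
  rcases (norm_nonneg M).eq_or_lt with h | h
  · rw [← h, mul_zero]; exact hC.le
  · calc min 1 (C / ‖M‖) * ‖M‖ ≤ C / ‖M‖ * ‖M‖ := by gcongr; exact min_le_right _ _
      _ = C := div_mul_cancel₀ _ h.ne'

lemma frobNorm_aggregate_le {X Y : Type*} {N m n r : ℕ} (p : Params X Y m n r) (hC : 0 < p.C)
    (D : Dataset X Y N) (S : Fin N → Bool)
    (b : (i : Fin N) → Fin p.L → Fin (D i).length → Bool) (s : Mat r n × Mat m r) :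
    frobNorm (aggregate p D S b s) ≤ p.C := by
  rw [aggregate, frobNorm_eq_norm, norm_smul, Real.norm_of_nonneg (by positivity)]
  set F := Finset.univ.filter fun i => S i = true
  have h : ‖∑ i ∈ F, clip p.C ((localTrain p (D i) (b i) s).2 * (localTrain p (D i) (b i) s).1)‖
      ≤ F.card * p.C := by
    rw [← nsmul_eq_mul, ← Finset.sum_const]
    refine norm_sum_le_of_le F fun i _ => ?_
    rw [← frobNorm_eq_norm]
    exact frobNorm_clip_le hC _
  rcases F.card.eq_zero_or_pos with h0 | h0
  · simp [h0, hC.le]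
  · have h0' : (0 : ℝ) < F.card := by exact_mod_cast h0
    calc (F.card : ℝ)⁻¹ * _ ≤ (F.card : ℝ)⁻¹ * (F.card * p.C) := by gcongr
      _ = p.C := by field_simp

end Frobenius

lemma frobNorm_transpose {a b : ℕ} (M : Mat a b) : frobNorm M.transpose = frobNorm M := by
  rw [frobNorm, frobNorm, Finset.sum_comm]
  rfl

/-- Bessel's inequality; the vectors that Gram–Schmidt replaces by zero contribute nothing. -/
lemma sum_sq_inner_gramSchmidtNormed_le {a b : ℕ} (f : Fin a → EuclideanSpace ℝ (Fin b))
    (x : EuclideanSpace ℝ (Fin b)) :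
    ∑ i, inner ℝ (InnerProductSpace.gramSchmidtNormed ℝ f i) x ^ 2 ≤ ‖x‖ ^ 2 := by
  classical
  have h := (InnerProductSpace.gramSchmidtNormed_orthonormal' (𝕜 := ℝ) f).sum_inner_products_le
    (s := Finset.univ) x
  refine le_trans (le_of_eq ?_) h
  simp only [Real.norm_eq_abs, sq_abs]
  rw [← Finset.sum_subset (Finset.filter_subset
    (fun i => InnerProductSpace.gramSchmidtNormed ℝ f i ≠ 0) Finset.univ)]
  · exact Finset.sum_subtype _ (fun i => by simp) _
  · intro i _ hi
    have hi : InnerProductSpace.gramSchmidtNormed ℝ f i = 0 := by simpa using hi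
    simp [hi]

lemma frobNorm_mul_orthRows_transpose_le {a b c : ℕ} (W : Mat a b) (M : Mat c b) :
    frobNorm (W * (orthRows M).transpose) ≤ frobNorm W := by
  refine Real.sqrt_le_sqrt (Finset.sum_le_sum fun i _ => ?_)
  have h := sum_sq_inner_gramSchmidtNormed_le (fun i' : Fin c => WithLp.toLp 2 (M i'))
    (WithLp.toLp 2 (W i))
  rw [EuclideanSpace.real_norm_sq_eq] at h
  refine le_trans (le_of_eq (Finset.sum_congr rfl fun j _ => ?_)) h
  rw [Matrix.mul_apply, PiLp.inner_apply]
  rfl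

lemma frobNorm_orthRows_mul_le {a b c : ℕ} (W : Mat a b) (M : Mat c a) :
    frobNorm (orthRows M * W) ≤ frobNorm W := by
  rw [← frobNorm_transpose, Matrix.transpose_mul, ← frobNorm_transpose W]
  exact frobNorm_mul_orthRows_transpose_le _ _

/-- After at least one subspace iteration the two matrices that PowerDP perturbs by noise are no
larger than its input, because both arise from it by multiplication with a partial isometry. -/
lemma frobNorm_powerStep_iterate_le {m n r k : ℕ} (hk : 1 ≤ k) (W : Mat m n)
    (s : Mat r n × Mat r n) :
    frobNorm ((powerStep W)^[k] s).1 ≤ frobNorm W ∧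
      frobNorm (W * ((powerStep W)^[k] s).2.transpose) ≤ frobNorm W := by
  obtain ⟨k, rfl⟩ := Nat.exists_eq_add_of_le' hk
  rw [Function.iterate_succ_apply']
  exact ⟨frobNorm_orthRows_mul_le _ _, frobNorm_mul_orthRows_transpose_le _ _⟩

/-! ### Sign symmetry of the refactorization -/

lemma gramSchmidt_neg {a b : ℕ} (f : Fin a → EuclideanSpace ℝ (Fin b)) (i : Fin a) :
    InnerProductSpace.gramSchmidt ℝ (-f) i = -InnerProductSpace.gramSchmidt ℝ f i := by
  induction i using WellFoundedLT.induction with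
  | ind i ih =>
    rw [InnerProductSpace.gramSchmidt_def ℝ (-f) i, InnerProductSpace.gramSchmidt_def ℝ f i,
      neg_sub', ← Finset.sum_neg_distrib]
    congr 1
    refine Finset.sum_congr rfl fun j hj => ?_
    rw [Submodule.starProjection_singleton, Submodule.starProjection_singleton,
      ih j (Finset.mem_Iio.1 hj)]
    simp

lemma orthRows_neg {a b : ℕ} (M : Mat a b) : orthRows (-M) = -orthRows M := by
  ext i j
  have h := gramSchmidt_neg (fun i' : Fin a => WithLp.toLp 2 (M i')) i
  have e : (-fun i' : Fin a => (WithLp.toLp 2 (M i') : EuclideanSpace ℝ (Fin b))) =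
    fun i' : Fin a => WithLp.toLp 2 ((-M) i') := rfl
  rw [e] at h
  simp [orthRows, InnerProductSpace.gramSchmidtNormed, h]

/-- The set of noisy factors `(B, A)` whose released product lies in `S`. -/
def factorSet {m n r : ℕ} (W₀ : Mat m n) (S : Set (Mat m n)) : Set (Mat m r × Mat r n) :=
  {z | W₀ + z.1 * orthRows z.2 ∈ S}

lemma measurableSet_factorSet {m n r : ℕ} (W₀ : Mat m n) {S : Set (Mat m n)}
    (hS : MeasurableSet S) : MeasurableSet (factorSet (r := r) W₀ S) :=
  measurable_madd measurable_const
    (measurable_mul measurable_fst (measurable_orthRows.comp measurable_snd)) hS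

lemma neg_mem_factorSet {m n r : ℕ} (W₀ : Mat m n) (S : Set (Mat m n)) (z : Mat m r × Mat r n) :
    -z ∈ factorSet W₀ S ↔ z ∈ factorSet W₀ S := by
  simp [factorSet, orthRows_neg]

/-- The law of the noise `(Z_B, Z_A)` of PowerDP. -/
noncomputable abbrev noiseLaw (m n r : ℕ) (s : ℝ) : Measure (Mat m r × Mat r n) :=
  (gaussianMatrix m r s).prod (gaussianMatrix r n s)

lemma exists_hasGaussianShift_noiseLaw {m n r : ℕ} {σ C : ℝ} (hσ : 0 < σ) (hC : 0 < C)
    {MB : Mat m r} {MA : Mat r n} (hB : frobNorm MB ≤ C) (hA : frobNorm MA ≤ C) :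
    ∃ φ q, HasGaussianShift (noiseLaw m n r (σ * C)) (MB, MA) φ q ∧ 0 ≤ q ∧ q ≤ 2 / σ ^ 2 := by
  have hs : σ * C ≠ 0 := by positivity
  obtain ⟨φ, hφ⟩ := exists_hasGaussianShift_gaussianMatrix hs MB
  obtain ⟨ψ, hψ⟩ := exists_hasGaussianShift_gaussianMatrix hs MA
  refine ⟨_, _, hφ.prod hψ, by positivity, ?_⟩
  have hle : ∀ x : ℝ, 0 ≤ x → x ≤ C → x ^ 2 / (σ * C) ^ 2 ≤ 1 / σ ^ 2 := fun x h0 h => by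
    rw [div_le_div_iff₀ (by positivity) (by positivity), mul_pow]
    have : x ^ 2 ≤ C ^ 2 := by gcongr
    nlinarith [sq_nonneg σ]
  have h1 := hle _ (Real.sqrt_nonneg _) hB
  have h2 := hle _ (Real.sqrt_nonneg _) hA
  have : 2 / σ ^ 2 = 1 / σ ^ 2 + 1 / σ ^ 2 := by ring
  rw [this]
  exact add_le_add h1 h2

/-! ### The last round of an iterated random map -/

/-- The result of iterating a random map `T ≥ 1` times with independent randomness is one
application of the map, with fresh randomness, to an independent random state. -/
lemma exists_law_foldl {M R Ω : Type*} [MeasurableSpace M] [MeasurableSpace R]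
    [MeasurableSpace Ω] (F : M → R → M) (hF : Measurable fun x : M × R => F x.1 x.2)
    (μ : Measure Ω) [IsProbabilityMeasure μ] (ρ : Measure R) [IsProbabilityMeasure ρ]
    {T : ℕ} (hT : T ≠ 0) {a : Ω → M} (ha : Measurable a) :
    ∃ ν : Measure M, IsProbabilityMeasure ν ∧
      (μ.prod (Measure.pi fun _ : Fin T => ρ)).map
        (fun ω => Fin.foldl T (fun s t => F s (ω.2 t)) (a ω.1)) =
      (ν.prod ρ).map fun x => F x.1 x.2 := by
  obtain ⟨T, rfl⟩ := Nat.exists_eq_succ_of_ne_zero hT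
  -- the state before the last round
  let g : Ω × (Fin T → R) → M := fun ω => Fin.foldl T (fun s t => F s (ω.2 t)) (a ω.1)
  have hg : Measurable g := measurable_foldl F hF T (ω := fun ω : Ω × (Fin T → R) => ω.2)
    (ha.comp measurable_fst) fun t => (measurable_pi_apply t).comp measurable_snd
  refine ⟨(μ.prod (Measure.pi fun _ : Fin T => ρ)).map g,
    Measure.isProbabilityMeasure_map hg.aemeasurable, ?_⟩
  have hsplit := measurePreserving_piFinSuccAbove (fun _ : Fin (T + 1) => ρ) (Fin.last T)
  have hswap : (Measure.pi fun _ : Fin (T + 1) => ρ).map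
      (fun ω : Fin (T + 1) → R => ((fun t : Fin T => ω t.castSucc), ω (Fin.last T))) =
      (Measure.pi fun _ : Fin T => ρ).prod ρ := by
    have h := congrArg (Measure.map Prod.swap) hsplit.map_eq
    rw [Measure.map_map measurable_swap hsplit.measurable, Measure.prod_swap] at h
    rw [← h]
    congr 1
    ext ω t
    · simp [MeasurableEquiv.piFinSuccAbove, Fin.init]
    · simp [MeasurableEquiv.piFinSuccAbove]
  have hpair : Measurable fun ω : Fin (T + 1) → R =>
      ((fun t : Fin T => ω t.castSucc), ω (Fin.last T)) := by fun_prop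
  have h1 := Measure.map_prod_map μ (Measure.pi fun _ : Fin (T + 1) => ρ) measurable_id hpair
  rw [hswap, Measure.map_id] at h1
  have h2 := Measure.map_prod_map (μ.prod (Measure.pi fun _ : Fin T => ρ)) ρ hg measurable_id
  rw [Measure.map_id] at h2
  have hassoc : (μ.prod (Measure.pi fun _ : Fin T => ρ)).prod ρ =
      (μ.prod ((Measure.pi fun _ : Fin T => ρ).prod ρ)).map MeasurableEquiv.prodAssoc.symm := by
    rw [← Measure.prodAssoc_prod, MeasurableEquiv.map_symm_map]
  have hg' : Measurable (Prod.map g (id : R → R)) := hg.prodMap measurable_id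
  have ha' := MeasurableEquiv.prodAssoc (α := Ω) (β := Fin T → R) (γ := R) |>.symm.measurable
  rw [h2, hassoc, h1, Measure.map_map hF hg', Measure.map_map (hF.comp hg') ha',
    Measure.map_map ((hF.comp hg').comp ha') (measurable_id.prodMap hpair)]
  congr 1
  ext ω
  simp only [Fin.foldl_succ_last]
  rfl

section Sections

variable {α β : Type*} [MeasurableSpace α] [MeasurableSpace β] {μ : Measure α}
  [IsProbabilityMeasure μ] {ν : Measure β} [SFinite ν] {s : Set (α × β)} {K : ENNReal}

lemma measure_prod_le_of_forall_section (hs : MeasurableSet s)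
    (h : ∀ x, ν (Prod.mk x ⁻¹' s) ≤ K) : μ.prod ν s ≤ K := by
  rw [Measure.prod_apply hs]
  exact (lintegral_mono h).trans (by simp)

lemma le_measure_prod_of_forall_section (hs : MeasurableSet s)
    (h : ∀ x, K ≤ ν (Prod.mk x ⁻¹' s)) : K ≤ μ.prod ν s := by
  rw [Measure.prod_apply hs]
  exact le_trans (by simp) (lintegral_mono h)

end Sections

/-! ### Privacy of the last round -/

section Privacy

variable {X Y : Type*} {N m n r : ℕ}

/-- Given everything but the noise of the last round, the released factors are the noise shifted
by a matrix pair of Frobenius norms at most `C`. Hence a bound on the mass of all such shifts of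
`factorSet` carries over to the law of the output. -/
lemma fedPower_apply_bounds (p : Params X Y m n r) (D : Dataset X Y N) (hk : 1 ≤ p.k)
    (hC : 0 < p.C) (hT : p.T ≠ 0) {S : Set (Mat m n)} (hS : MeasurableSet S) :
    (∀ K : ENNReal, (∀ (MB : Mat m r) (MA : Mat r n), frobNorm MB ≤ p.C → frobNorm MA ≤ p.C →
        noiseLaw m n r (p.σ * p.C) ((· + (MB, MA)) ⁻¹' factorSet p.W₀ S) ≤ K) →
      fedPower p D S ≤ K) ∧
    (∀ K : ENNReal, (∀ (MB : Mat m r) (MA : Mat r n), frobNorm MB ≤ p.C → frobNorm MA ≤ p.C →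
        K ≤ noiseLaw m n r (p.σ * p.C) ((· + (MB, MA)) ⁻¹' factorSet p.W₀ S)) →
      K ≤ fedPower p D S) := by
  have hF : Measurable fun x : (Mat r n × Mat m r) × RoundRandomness p D =>
      globalRound p D x.1 x.2 := measurable_globalRound p D measurable_fst measurable_snd
  obtain ⟨ν, hν, hlaw⟩ := exists_law_foldl (globalRound p D) hF (gaussianMatrix r n p.σ)
    (roundLaw p D) hT (a := fun A => ((A, 0) : Mat r n × Mat m r))
    (measurable_id.prodMk measurable_const)
  have hG : Measurable fun s : Mat r n × Mat m r => p.W₀ + s.2 * s.1 :=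
    measurable_madd measurable_const (measurable_mul measurable_snd measurable_fst)
  have hfold := measurable_foldl (globalRound p D) hF p.T
    (a := fun ω : Randomness p D => ((ω.1, 0) : Mat r n × Mat m r))
    (ω := fun ω => ω.2) (measurable_fst.prodMk measurable_const)
    (fun t => (measurable_pi_apply t).comp measurable_snd)
  have hmap : fedPower p D = (ν.prod (roundLaw p D)).map
      ((fun s : Mat r n × Mat m r => p.W₀ + s.2 * s.1) ∘ fun x => globalRound p D x.1 x.2) := by
    rw [← Measure.map_map hG hF, ← hlaw, Measure.map_map hG hfold]
    rfl
  set U := ((fun s : Mat r n × Mat m r => p.W₀ + s.2 * s.1) ∘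
    fun x : (Mat r n × Mat m r) × RoundRandomness p D => globalRound p D x.1 x.2) ⁻¹' S with hU
  have hUm : MeasurableSet U := (hG.comp hF) hS
  have hval : fedPower p D S = ν.prod (roundLaw p D) U := by
    rw [hmap, Measure.map_apply (hG.comp hF) hS]
  -- the section of `U` at a fixed value of everything but the last noise
  have hsec : ∀ s c b Q, ∃ (MB : Mat m r) (MA : Mat r n), frobNorm MB ≤ p.C ∧ frobNorm MA ≤ p.C ∧
      Prod.mk Q ⁻¹' (Prod.mk b ⁻¹' (Prod.mk c ⁻¹' (Prod.mk s ⁻¹' U))) =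
        (· + (MB, MA)) ⁻¹' factorSet p.W₀ S := by
    intro s c b Q
    have hW := frobNorm_aggregate_le p hC D c b s
    obtain ⟨hA, hB⟩ := frobNorm_powerStep_iterate_le hk (aggregate p D c b s) ((0 : Mat r n), Q)
    refine ⟨_, _, hB.trans hW, hA.trans hW, ?_⟩
    ext z
    simp only [hU, Set.mem_preimage, factorSet, Set.mem_ofPred_eq, Function.comp, globalRound,
      powerDP, Prod.fst_add, Prod.snd_add]
    rw [add_comm z.1, add_comm z.2]
  rw [hval]
  have m1 := fun s => measurable_prodMk_left (x := s) hUm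
  have m2 := fun s c => measurable_prodMk_left (x := c) (m1 s)
  have m3 := fun s c b => measurable_prodMk_left (x := b) (m2 s c)
  refine ⟨fun K h => ?_, fun K h => ?_⟩
  · refine measure_prod_le_of_forall_section hUm fun s =>
      measure_prod_le_of_forall_section (m1 s) fun c =>
      measure_prod_le_of_forall_section (m2 s c) fun b =>
      measure_prod_le_of_forall_section (m3 s c b) fun Q => ?_
    obtain ⟨MB, MA, hB, hA, e⟩ := hsec s c b Q
    rw [e]
    exact h MB MA hB hA
  · refine le_measure_prod_of_forall_section hUm fun s =>
      le_measure_prod_of_forall_section (m1 s) fun c =>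
      le_measure_prod_of_forall_section (m2 s c) fun b =>
      le_measure_prod_of_forall_section (m3 s c b) fun Q => ?_
    obtain ⟨MB, MA, hB, hA, e⟩ := hsec s c b Q
    rw [e]
    exact h MB MA hB hA

/-- Of the two bounds `cosh x ≤ exp |x|` and `cosh x ≤ exp (x² / 2)`, the first is the useful one
for large `ε` and the second for small `ε`. -/
lemma le_abs_of_exp_lt_cosh {ε x : ℝ} (h : Real.exp (ε / 2) < Real.cosh x) :
    max (ε / 2) (√ε) ≤ |x| := by
  refine max_le (Real.exp_le_exp.1 (h.le.trans (cosh_le_exp_abs x))) ?_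
  have h2 := Real.exp_le_exp.1 (h.le.trans (Real.cosh_le_exp_half_sq x))
  exact Real.sqrt_le_iff.2 ⟨abs_nonneg x, by rw [sq_abs]; linarith⟩

/-- One-round privacy: the sign symmetry makes the privacy loss quadratic in `1 / σ`, so noise with
`σ² ≥ 8 / ε` and `σ² ≥ 16 log (2 / δ) / ε` suffices, for arbitrary pairs of datasets. -/
lemma fedPower_isDP_of_sq_mul_le (p : Params X Y m n r) {ε δ : ℝ} (hk : 1 ≤ p.k) (hC : 0 < p.C)
    (hT : p.T ≠ 0) (hσ : 0 < p.σ) (hε : 0 < ε) (hδ : 0 < δ) (h8 : 8 ≤ p.σ ^ 2 * ε)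
    (hlog : 16 * Real.log (2 / δ) ≤ p.σ ^ 2 * ε)
    (adj : Dataset X Y N → Dataset X Y N → Prop) : IsDP adj (fedPower p) ε δ := by
  intro D D' _ S hS
  set U := factorSet (r := r) p.W₀ S
  have hUm : MeasurableSet U := measurableSet_factorSet p.W₀ hS
  have hUneg : ∀ z, -z ∈ U ↔ z ∈ U := neg_mem_factorSet p.W₀ S
  set κ := 2 / p.σ ^ 2 with hκ
  have hκ0 : 0 < κ := by positivity
  have hκσ : κ * p.σ ^ 2 = 2 := div_mul_cancel₀ _ (by positivity)
  have hκε : κ ≤ ε / 4 := by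
    rw [hκ, div_le_iff₀ (by positivity)]; linarith
  set t := max (ε / 2) (√ε) with ht
  have ht1 : ε / 2 ≤ t := le_max_left _ _
  have ht2 : ε ≤ t ^ 2 := by
    calc ε = √ε ^ 2 := (Real.sq_sqrt hε.le).symm
      _ ≤ t ^ 2 := by gcongr; exact le_max_right _ _
  have ht0 : 0 < t := by linarith
  -- `t / (2κ)` has the order of the minimizer `t / κ - 1` of the Chernoff exponent
  have hexp : (t / (2 * κ) + (t / (2 * κ)) ^ 2 / 2) * κ - t / (2 * κ) * t ≤
      -Real.log (2 / δ) := by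
    have e : (t / (2 * κ) + (t / (2 * κ)) ^ 2 / 2) * κ - t / (2 * κ) * t =
        t / 2 - 3 * (t ^ 2 / κ) / 8 := by field_simp; ring
    have e1 : t ^ 2 / κ = t ^ 2 * p.σ ^ 2 / 2 := by
      rw [div_eq_iff hκ0.ne']; linear_combination (-t ^ 2 / 2) * hκσ
    have e2 : 2 * t ≤ t ^ 2 / κ := by
      rw [le_div_iff₀ hκ0]; nlinarith
    have e3 : p.σ ^ 2 * ε ≤ p.σ ^ 2 * t ^ 2 := by gcongr
    rw [e]
    nlinarith
  have hδ' : 2 * Real.exp ((t / (2 * κ) + (t / (2 * κ)) ^ 2 / 2) * κ - t / (2 * κ) * t) ≤ δ := by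
    calc _ ≤ 2 * Real.exp (-Real.log (2 / δ)) := by gcongr
      _ = δ := by rw [Real.exp_neg, Real.exp_log (by positivity)]; field_simp
  have hup : fedPower p D S ≤ ENNReal.ofReal (Real.exp (ε / 2)) *
      noiseLaw m n r (p.σ * p.C) U + ENNReal.ofReal δ := by
    refine (fedPower_apply_bounds p D hk hC hT hS).1 _ fun MB MA hB hA => ?_
    obtain ⟨φ, q, h, hq0, hq⟩ := exists_hasGaussianShift_noiseLaw hσ hC hB hA
    refine (h.measure_shift_le (κ := κ) (τ := ε / 2) (t := t) (lam := t / (2 * κ)) hq0 hq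
      (by positivity)
      (fun x hx => le_abs_of_exp_lt_cosh hx) hUm hUneg).trans ?_
    gcongr
  have hlow : noiseLaw m n r (p.σ * p.C) U ≤
      ENNReal.ofReal (Real.exp (κ / 2)) * fedPower p D' S := by
    have he : ENNReal.ofReal (Real.exp (κ / 2)) ≠ 0 := by simp [Real.exp_pos]
    rw [← ENNReal.div_le_iff' he ENNReal.ofReal_ne_top]
    refine (fedPower_apply_bounds p D' hk hC hT hS).2 _ fun MB MA hB hA => ?_
    obtain ⟨φ, q, h, hq0, hq⟩ := exists_hasGaussianShift_noiseLaw hσ hC hB hA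
    rw [ENNReal.div_le_iff' he ENNReal.ofReal_ne_top]
    exact h.measure_le_measure_shift hq hUm hUneg
  calc fedPower p D S ≤ ENNReal.ofReal (Real.exp (ε / 2)) *
        (ENNReal.ofReal (Real.exp (κ / 2)) * fedPower p D' S) + ENNReal.ofReal δ :=
        hup.trans (by gcongr)
    _ ≤ _ := by
        rw [← mul_assoc, ← ENNReal.ofReal_mul (Real.exp_nonneg _), ← Real.exp_add]
        gcongr
        linarith

end Privacy

end FedPower

theorem mainTheorem3 (δ₀ : ℝ) (hδ₀ : δ₀ < 1) :
    ∃ c : ℝ, 0 < c ∧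
      ∀ (X Y : Type*) (N m n r : ℕ) (p : FedPower.Params X Y m n r) (ε δ : ℝ),
        1 ≤ p.k → 0 < p.C → 0 < ε →
        ε < c * (p.qc : ℝ) ^ 2 * (p.qs : ℝ) ^ 2 * (p.T : ℝ) →
        0 < δ → δ ≤ δ₀ →
        c * ((p.qc : ℝ) * (p.qs : ℝ) * √((p.T : ℝ) * Real.log (1 / δ)) / ε) ≤ p.σ →
        FedPower.IsDP (FedPower.SampleAdjacent (X := X) (Y := Y) (N := N))
          (FedPower.fedPower p) ε δ := by
  -- `l₀ > 0` is a lower bound for `log (1 / δ)`; the maximum keeps it meaningful for `δ₀ ≤ 0`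
  set l₀ := Real.log (1 / max δ₀ (1 / 2)) with hl₀
  have hm0 : 0 < max δ₀ (1 / 2) := lt_max_of_lt_right (by norm_num)
  have hl₀pos : 0 < l₀ := Real.log_pos (by
    rw [lt_div_iff₀ hm0, one_mul]; exact max_lt hδ₀ (by norm_num))
  refine ⟨16 * (1 + 1 / l₀), by positivity, ?_⟩
  intro X Y N m n r p ε δ hk hC hε hεc hδ hδδ₀ hσc
  set c := 16 * (1 + 1 / l₀) with hc
  have hc0 : 0 < c := by positivity
  have hT : p.T ≠ 0 := by
    rintro h
    rw [h] at hεc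
    simp at hεc
    linarith
  set l := Real.log (1 / δ) with hl
  have hll : l₀ ≤ l := by
    refine Real.log_le_log (by positivity) ?_
    gcongr
    exact hδδ₀.trans (le_max_left _ _)
  set u := (p.qc : ℝ) * (p.qs : ℝ) with hu
  have hu0 : 0 ≤ u := mul_nonneg p.qc.2.1 p.qs.2.1
  have hεc' : ε < c * (u ^ 2 * p.T) := by rw [hu]; linarith
  have huT : 0 < u ^ 2 * p.T := by
    by_contra! h
    nlinarith
  have hupos : 0 < u := hu0.lt_of_ne fun h => by simp [← h] at huT
  have hTl : 0 < (p.T : ℝ) * l := mul_pos (by positivity) (by linarith)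
  have hσ : 0 < p.σ := lt_of_lt_of_le (by positivity) hσc
  -- eliminating `u² T` between the two hypotheses leaves `c log (1 / δ) ≤ σ² ε`
  have key : c * l ≤ p.σ ^ 2 * ε := by
    have h1 : (c * (u * √(p.T * l) / ε)) ^ 2 ≤ p.σ ^ 2 := by gcongr
    have h2 : (c * (u * √(p.T * l) / ε)) ^ 2 * ε = (c * l) * (c * (u ^ 2 * p.T) / ε) := by
      rw [mul_pow, div_pow, mul_pow u, Real.sq_sqrt hTl.le]
      field_simp
    have h3 : 1 ≤ c * (u ^ 2 * p.T) / ε := (one_le_div hε).2 hεc'.le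
    have h4 : c * l ≤ (c * l) * (c * (u ^ 2 * p.T) / ε) :=
      le_mul_of_one_le_right (mul_nonneg hc0.le (by linarith)) h3
    calc c * l ≤ _ := h4
      _ = _ := h2.symm
      _ ≤ _ := by gcongr
  have hcl : 16 * l + 16 ≤ c * l := by
    have : 1 ≤ 1 / l₀ * l := by rw [one_div_mul_eq_div]; exact (one_le_div hl₀pos).2 hll
    rw [hc]
    linarith
  have hlog : Real.log (2 / δ) ≤ 1 + l := by
    rw [hl, div_eq_mul_one_div 2 δ, Real.log_mul (by norm_num) (by positivity)]
    linarith [Real.log_two_lt_d9]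
  exact FedPower.fedPower_isDP_of_sq_mul_le p hk hC hT hσ hε hδ (by linarith) (by linarith) _
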